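/- **Theorem 3 (Comparison of entanglement cost between spreading and concentrating).** Let $T=(V,E)$ be a tree on parties $v_1,\dots,v_N$ with root $v_1$ and an ascending labeling (every vertex $v_{k'}$ on the path from $v_1$ to $v_k$ has $k'\le k$), and let $p(v_k)$ be the parent of $v_k$ and $D'_{v_k}$ the set of $v_k$ and its descendants. Let $\mathcal H=\mathbb C^D$, $D\ge1$, let $\tilde{\mathcal H}^{v}$ $(v\in V)$ be finite-dimensional Hilbert spaces, let $U:\mathcal H\to\bigotimes_{v\in V}\tilde{\mathcal H}^{v}$ be an isometry, and put $$|\tilde\Phi_D^+\rangle=\frac1{\sqrt D}\sum_{l=0}^{D-1}|l\rangle^R\otimes U|l\rangle .$$ For $e=\{p(v_k),v_k\}\in E$ let $\tilde\Phi^+_{D,e}$ be the reduced state of $|\tilde\Phi_D^+\rangle$ on $\bigotimes_{v\in D'_{v_k}}\tilde{\mathcal H}^{v}$; the number $\log_2\operatorname{rank}\tilde\Phi^+_{D,e}$ is the cost of spreading for the edge $e$. Consider any run of the concentrating algorithm, with resource states $|\Phi^+_{M_e}\rangle=M_e^{-1/2}\sum_{x}|x\rangle\otimes|x\rangle$, $M_e\ge1$,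 on the edges. It starts from $|\Phi^N\rangle=|\tilde\Phi_D^+\rangle$, and the parties $v_N,\dots,v_2$ act in this order. When $v_k$ acts, after outcomes $\boldsymbol m_k=(m^{v_N},\dots,m^{v_{k+1}})$ of nonzero probability, the parties $v_1,\dots,v_k$ share with $R$ a pure state $|\Phi^k_{\boldsymbol m_k}\rangle$, and $v_k$ performs, with $e=\{p(v_k),v_k\}$, a rank-one measurement $\{|m\rangle\}_m$, $\sum_m|m\rangle\langle m|=\mathbb 1$, on its system and its half of $|\Phi^+_{M_e}\rangle$ that achieves exact state merging of $|\Phi^k_{\boldsymbol m_k}\rangle$ from $A=v_k$ to $B=v_1\cdots v_{k-1}$: for every outcome $m$ of nonzero probability, some isometry $U_m$ on the systems of $B$ (including its half of $|\Phi^+_{M_e}\rangle$) maps the normalized vector $(\mathbb 1\otimes\langle m|)(|\Phi^k_{\boldsymbol m_k}\rangle\otimes|\Phi^+_{M_e}\rangle)$ to $|\Phi^k_{\boldsymbol m_k}\rangle$ with the system of $v_k$ replaced by a copy at $B$. The next state $|\Phi^{k-1}_{\boldsymbol m_{k-1}}\rangle$ is this normalized vector (the $U_m$ need not be applied), and the half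 of $|\Phi^+_{M_e}\rangle$ at $p(v_k)$ becomes part of the system of $p(v_k)$. Let $$|\Phi^k_{\boldsymbol m_k}\rangle=\bigoplus_{j}\sqrt{p_{\boldsymbol m_k}(j)}\,|\omega_{\boldsymbol m_k,j}\rangle\otimes|\phi_{\boldsymbol m_k,j}\rangle$$ be the Koashi–Imoto decomposition with respect to $R$, $A=v_k$, $B=v_1\cdots v_{k-1}$. That is, all $p_{\boldsymbol m_k}(j)>0$; the supports of the reduced states on $A$ and on $B$ are decomposed as $\bigoplus_j\mathcal H_{\boldsymbol m_k}^{(v_k)_j^L}\otimes\mathcal H_{\boldsymbol m_k}^{(v_k)_j^R}$ and $\bigoplus_j\mathcal H_{\boldsymbol m_k}^{(v_1\cdots v_{k-1})_j^L}\otimes\mathcal H_{\boldsymbol m_k}^{(v_1\cdots v_{k-1})_j^R}$; the unit vector $\omega_{\boldsymbol m_k,j}$ lives on the two $L$-factors and the unit vector $\phi_{\boldsymbol m_k,j}$ on $R$ and the two $R$-factors; and every Kraus operator of every quantum channel on $A$ that leaves the reduced state on $RA$ invariant acts on the support of the reduced state on $A$ as $\bigoplus_j L_j\otimes\mathbb 1$.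 Let $\lambda_{\boldsymbol m_k,0}^{(v_k)_j^L}$ be the largest eigenvalue of the reduced state of $\omega_{\boldsymbol m_k,j}$ on $\mathcal H_{\boldsymbol m_k}^{(v_k)_j^L}$. Then for every edge $e=\{p(v_k),v_k\}\in E$, $$\max_{\boldsymbol m_k,j}\left\{\log_2\left\lceil\lambda_{\boldsymbol m_k,0}^{(v_k)_j^L}\dim\mathcal H_{\boldsymbol m_k}^{(v_k)_j^R}\right\rceil\right\}\le\log_2\operatorname{rank}\tilde\Phi^+_{D,e},$$ the maximum being over all outcome tuples $\boldsymbol m_k$ of nonzero probability and all $j$. Consequently, if $\log_2M_e$ equals the left-hand side for every $e\in E$, then $\sum_{e\in E}\log_2M_e\le\sum_{e\in E}\log_2\operatorname{rank}\tilde\Phi^+_{D,e}$. -/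

import Mathlib

open scoped Matrix Kronecker

noncomputable section

/-! ### Rooted trees with an ascending labelling -/

/-- A tree whose vertices carry the labels `0, …, n` (there are `n + 1` vertices); the vertex `0` is
the root.  The labelling is ascending: every vertex on a path from the root to `k` has a label
at most `k`. -/
structure AscendingTree (n : ℕ) where
  graph : SimpleGraph (Fin (n + 1))
  isTree : graph.IsTree
  ascending : ∀ (k l : Fin (n + 1)) (p : graph.Walk 0 k), p.IsPath → l ∈ p.support → l ≤ k

namespace AscendingTree

variable {n : ℕ} (T : AscendingTree n)

/-- The path from the root to `k`. -/
def path (k : Fin (n + 1)) : T.graph.Walk 0 k :=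
  (T.isTree.existsUnique_path 0 k).choose

theorem path_isPath (k : Fin (n + 1)) : (T.path k).IsPath :=
  (T.isTree.existsUnique_path 0 k).choose_spec.1

/-- The parent of a non-root vertex `k`: the vertex before `k` on the path from the root to `k`. -/
def parent (k : Fin (n + 1)) : Fin (n + 1) := (T.path k).penultimate

theorem adj_parent (i : Fin n) : T.graph.Adj (T.parent i.succ) i.succ :=
  SimpleGraph.Walk.adj_penultimate
    (SimpleGraph.Walk.not_nil_of_ne (Fin.succ_ne_zero i).symm)

theorem parent_succ_le (i : Fin n) : T.parent i.succ ≤ i.castSucc := by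
  have h1 : T.parent i.succ ≤ i.succ :=
    T.ascending _ _ (T.path i.succ) (T.path_isPath _)
      ((T.path i.succ).getVert_mem_support _)
  have h2 : T.parent i.succ ≠ i.succ := (T.adj_parent i).ne
  have h3 := lt_of_le_of_ne h1 h2
  exact Fin.le_castSucc_iff.2 h3

/-- The set consisting of `k` and its descendants: the vertices `v` such that `k` lies on the path
from the root to `v`. -/
def subtree (k : Fin (n + 1)) : Set (Fin (n + 1)) := {v | k ∈ (T.path v).support}

end AscendingTree

/-! ### Vectors of composite systems in coordinates

Every finite-dimensional Hilbert space is given with an orthonormal basis, and a vector of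
`𝓗^R ⊗ 𝓗^A ⊗ 𝓗^B` is the family `ψ r a b` of its coefficients. -/

/-- The reduced state on the first system of the pure state with coefficients `ψ a e`
(the partial trace over the second system of `|ψ⟩⟨ψ|`). -/
def reducedState {A E : Type*} [Fintype E] (ψ : A → E → ℂ) : Matrix A A ℂ :=
  Matrix.of ψ * (Matrix.of ψ)ᴴ

/-- The norm of a tripartite vector. -/
def triNorm {R A B : Type*} [Fintype R] [Fintype A] [Fintype B] (ψ : R → A → B → ℂ) : ℝ :=
  √(∑ r, ∑ a, ∑ b, ‖ψ r a b‖ ^ 2)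

/-- The coefficients of the maximally entangled state of Schmidt rank `K`. -/
def maxEntangled (K : ℕ) (x y : Fin K) : ℂ := if x = y then ((1 / √(K : ℝ) : ℝ) : ℂ) else 0

/-- The largest eigenvalue of the reduced state on the first system of `ω`. -/
def maxSchmidt {a b : ℕ} (ω : Fin a → Fin b → ℂ) : ℝ :=
  ⨆ x, (Matrix.isHermitian_mul_conjTranspose_self (Matrix.of ω)).eigenvalues x

/-! ### The Koashi-Imoto decomposition -/

/-- A Koashi-Imoto decomposition of a tripartite pure state `ψ`.  As usual `𝓗^A` and `𝓗^B` are
identified with the supports of the reduced states of `ψ`; these supports are decomposed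
as `⨁ j, a_j^L ⊗ a_j^R` and `⨁ j, b_j^L ⊗ b_j^R` through isometries `V` and `W`. -/
structure KoashiImoto {R A B : Type} [Fintype R] [Fintype A] [Fintype B] [DecidableEq R]
    [DecidableEq A] [DecidableEq B] (ψ : R → A → B → ℂ) where
  /-- The number of blocks. -/
  J : ℕ
  /-- The dimensions of `a_j^L`, `a_j^R`, `b_j^L` and `b_j^R`. -/
  aL : Fin J → ℕ
  aR : Fin J → ℕ
  bL : Fin J → ℕ
  bR : Fin J → ℕ
  /-- The isometries onto the supports. -/
  V : Matrix A (Σ j, Fin (aL j) × Fin (aR j)) ℂ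
  W : Matrix B (Σ j, Fin (bL j) × Fin (bR j)) ℂ
  V_isometry : Vᴴ * V = 1
  W_isometry : Wᴴ * W = 1
  V_range : LinearMap.range V.mulVecLin =
    LinearMap.range (reducedState fun a (x : R × B) => ψ x.1 a x.2).mulVecLin
  W_range : LinearMap.range W.mulVecLin =
    LinearMap.range (reducedState fun b (x : R × A) => ψ x.1 x.2 b).mulVecLin
  /-- The probability distribution and the unit vectors of the blocks. -/
  p : Fin J → ℝ
  ω : ∀ j, Fin (aL j) → Fin (bL j) → ℂ
  φ : ∀ j, R → Fin (aR j) → Fin (bR j) → ℂ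
  p_pos : ∀ j, 0 < p j
  p_sum : ∑ j, p j = 1
  ω_unit : ∀ j, ∑ x, ∑ y, ‖ω j x y‖ ^ 2 = 1
  φ_unit : ∀ j, triNorm (φ j) = 1
  /-- `ψ` is the direct sum of the vectors `√(p j) • ω j ⊗ φ j`. -/
  decomp : ∀ r a b, ψ r a b = ∑ j, ∑ x : Fin (aL j) × Fin (aR j), ∑ y : Fin (bL j) × Fin (bR j),
    V a ⟨j, x⟩ * W b ⟨j, y⟩ * ((√(p j) : ℝ) : ℂ) * ω j x.1 y.1 * φ j r x.2 y.2
  /-- Maximality: every quantum channel on `A` (given by Kraus operators) that leaves the reduced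
  state on `R A` invariant acts on the support as `⨁ j, (operation on a_j^L) ⊗ 1`. -/
  maximal : ∀ (q : ℕ) (K : Fin q → Matrix A A ℂ), ∑ i, (K i)ᴴ * K i = 1 →
    (∑ i, ((1 : Matrix R R ℂ) ⊗ₖ K i) * (reducedState fun (x : R × A) b => ψ x.1 x.2 b) *
        ((1 : Matrix R R ℂ) ⊗ₖ K i)ᴴ = reducedState fun (x : R × A) b => ψ x.1 x.2 b) →
    ∀ i, ∃ L : ∀ j, Matrix (Fin (aL j)) (Fin (aL j)) ℂ,
      K i * V = V * Matrix.blockDiagonal' fun j => L j ⊗ₖ (1 : Matrix (Fin (aR j)) (Fin (aR j)) ℂ)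

/-! ### Exact state merging -/

section Merging

variable {R A B : Type} [Fintype R] [Fintype A] [Fintype B]

/-- The unnormalized vector `(1 ⊗ ⟨μ|) (ψ ⊗ Φ⁺_K)` on `R`, `B` and `B`'s half of the resource state,
where `μ` is a vector on `A` and `A`'s half of the resource state. -/
def unnormalizedPost (ψ : R → A → B → ℂ) {K : ℕ} (μ : A × Fin K → ℂ) (r : R) (b : B)
    (y : Fin K) : ℂ :=
  ∑ a, ∑ x, star (μ (a, x)) * (ψ r a b * maxEntangled K x y)

/-- The normalized post-measurement state (zero if the outcome has probability zero). -/
def postState (ψ : R → A → B → ℂ) {K : ℕ} (μ : A × Fin K → ℂ) (r : R) (b : B) (y : Fin K) : ℂ :=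
  ((triNorm (unnormalizedPost ψ μ))⁻¹ : ℝ) * unnormalizedPost ψ μ r b y

/-- The vectors `μ m` form a rank-one measurement (for example an orthonormal basis) on `A` and its
half of `Φ⁺_K` that achieves exact state merging of `ψ` from `A` to `B`: they resolve the identity,
and after every outcome of nonzero probability an isometry of `B` (depending on the
outcome) restores `ψ`, with the system of `A` replaced by a copy `B'` held by `B`. -/
def IsExactMerging [DecidableEq A] [DecidableEq B] (ψ : R → A → B → ℂ) {K : ℕ} {Ω : Type}
    [Fintype Ω] (μ : Ω → A × Fin K → ℂ) : Prop :=
  (∑ m, Matrix.vecMulVec (μ m) (star (μ m)) = 1) ∧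
  ∀ m, unnormalizedPost ψ (μ m) ≠ 0 →
    ∃ W : Matrix (A × B) (B × Fin K) ℂ, Wᴴ * W = 1 ∧
      ∀ r a b, ∑ x : B × Fin K, W (a, b) x * postState ψ (μ m) r x.1 x.2 = ψ r a b

end Merging

/-! ### Spreading -/

section Code

variable {n : ℕ} (d : Fin (n + 1) → ℕ) {D : ℕ}
  (U : EuclideanSpace ℂ (Fin D) →ₗᵢ[ℂ] EuclideanSpace ℂ (∀ k, Fin (d k)))

/-- The coefficients of `(1 ⊗ U) Φ⁺_D = D^{-1/2} ∑ r, |r⟩ ⊗ U |r⟩`. -/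
def codeState (r : Fin D) (x : ∀ k, Fin (d k)) : ℂ :=
  ((1 / √(D : ℝ) : ℝ) : ℂ) * U (EuclideanSpace.single r 1) x

open scoped Classical in
/-- The reduced state of `(1 ⊗ U) Φ⁺_D` on the systems of `k` and of the descendants of `k`. -/
def subtreeState (T : AscendingTree n) (k : Fin (n + 1)) :
    Matrix (∀ v : {v // v ∈ T.subtree k}, Fin (d v)) (∀ v : {v // v ∈ T.subtree k}, Fin (d v)) ℂ :=
  reducedState fun x (e : Fin D × (∀ v : {v // v ∉ T.subtree k}, Fin (d v))) =>
    codeState d U e.1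
      ((Equiv.piEquivPiSubtypeProd (· ∈ T.subtree k) fun v => Fin (d v)).symm (x, e.2))

open scoped Classical in
/-- The optimal cost of spreading for the edge from the parent of `i.succ` to `i.succ`: the base-two
logarithm of the rank of the reduced state on `i.succ` and its descendants. -/
def spreadingCost (T : AscendingTree n) (i : Fin n) : ℝ :=
  Real.logb 2 ((subtreeState d U T i.succ).rank : ℝ)

end Code

/-! ### The concentrating algorithm

Stage `s` of the algorithm is the one at which exactly the parties `0, …, s` still hold quantum
systems; stage `n` is the beginning.  In the step from stage `i.succ` to stage `i.castSucc` the
party `i.succ` merges its system to the others, using the edge to its parent, and the parent's half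
of the resource state becomes part of the parent's system. -/

/-- The data of a run of the algorithm: the Schmidt rank `M c` of the resource state on the edge from
the parent of `c` to `c`, the outcome set `Ω c` of party `c`, and the measurement vectors of the
party `i.succ`, which depend on the outcomes of the parties that measured before. -/
structure MeasurementScheme {n : ℕ} (T : AscendingTree n) (d : Fin (n + 1) → ℕ) where
  M : Fin (n + 1) → ℕ
  Ω : Fin (n + 1) → Type
  fintypeΩ : ∀ c, Fintype (Ω c)
  meas : ∀ i : Fin n, (∀ c : {c : Fin (n + 1) // i.succ < c}, Ω c) → Ω i.succ →
    ((Fin (d i.succ) ×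
        (∀ c : {c : Fin (n + 1) // i.succ < c ∧ T.parent c = i.succ}, Fin (M c))) ×
      Fin (M i.succ) → ℂ)

namespace MeasurementScheme

variable {n : ℕ} {T : AscendingTree n} {d : Fin (n + 1) → ℕ} (P : MeasurementScheme T d)

instance (c : Fin (n + 1)) : Fintype (P.Ω c) := P.fintypeΩ c

/-- The tuples of outcomes of the parties that have measured before stage `s`. -/
abbrev History (s : Fin (n + 1)) : Type := ∀ c : {c : Fin (n + 1) // s < c}, P.Ω c

/-- The basis of the system of party `l` at stage `s`: its original system, and its halves of the
resource states shared with those children that have already been merged. -/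
abbrev Loc (s l : Fin (n + 1)) : Type :=
  Fin (d l) × (∀ c : {c : Fin (n + 1) // s < c ∧ T.parent c = l}, Fin (P.M c))

/-- The basis of the joint system of the parties `0, …, s` at stage `s`. -/
abbrev Config (s : Fin (n + 1)) : Type := ∀ l : {l : Fin (n + 1) // l ≤ s}, P.Loc s l

/-- The basis of the joint system of the parties `0, …, i` at stage `i.succ`. -/
abbrev Rest (i : Fin n) : Type := ∀ l : {l : Fin (n + 1) // l ≤ i.castSucc}, P.Loc i.succ l

/-- The outcomes of the parties before party `i.succ`. -/
def prevHistory (i : Fin n) (m : P.History i.castSucc) : P.History i.succ :=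
  fun c => m ⟨c.1, (Fin.castSucc_lt_succ (i := i)).trans c.2⟩

/-- The outcome of party `i.succ`. -/
def lastOutcome (i : Fin n) (m : P.History i.castSucc) : P.Ω i.succ :=
  m ⟨i.succ, Fin.castSucc_lt_succ (i := i)⟩

/-- A configuration at stage `i.succ` consists of one of party `i.succ` and one of the rest. -/
def join (i : Fin n) (a : P.Loc i.succ i.succ) (b : P.Rest i) : P.Config i.succ :=
  fun l =>
    if h : l.1 ≤ i.castSucc then b ⟨l.1, h⟩
    else
      have e : i.succ = l.1 := le_antisymm (Fin.castSucc_lt_iff_succ_le.1 (not_le.1 h)) l.2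
      e ▸ a

/-- The part of a configuration at stage `i.castSucc` that is present at stage `i.succ`. -/
def old (i : Fin n) (z : P.Config i.castSucc) : P.Rest i :=
  fun l => ((z l).1, fun c => (z l).2 ⟨c.1, (Fin.castSucc_lt_succ (i := i)).trans c.2.1, c.2.2⟩)

/-- The half of the resource state on the edge from the parent of `i.succ` to `i.succ` that is held
by the parent. -/
def parentHalf (i : Fin n) (z : P.Config i.castSucc) : Fin (P.M i.succ) :=
  (z ⟨T.parent i.succ, T.parent_succ_le i⟩).2 ⟨i.succ, Fin.castSucc_lt_succ (i := i), rfl⟩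

variable {D : ℕ} (U : EuclideanSpace ℂ (Fin D) →ₗᵢ[ℂ] EuclideanSpace ℂ (∀ k, Fin (d k)))

/-- The state of the reference and of the parties `0, …, s` at stage `s`, given the outcomes so far:
it starts with `(1 ⊗ U) Φ⁺_D`, and the next state is the post-measurement state.  For
outcomes of probability zero it is `0`. -/
def state (s : Fin (n + 1)) : P.History s → Fin D → P.Config s → ℂ :=
  Fin.reverseInduction (motive := fun s => P.History s → Fin D → P.Config s → ℂ)
    (fun _ r z => codeState d U r fun k => (z ⟨k, Fin.le_last k⟩).1)
    (fun i Φ m r z =>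
      postState (fun r a b => Φ (P.prevHistory i m) r (P.join i a b))
        (P.meas i (P.prevHistory i m) (P.lastOutcome i m)) r (P.old i z) (P.parentHalf i z))
    s

/-- The state just before the measurement of party `i.succ`, as a tripartite state of the reference,
the party `i.succ` and the parties `0, …, i`. -/
def mergeState (i : Fin n) (m : P.History i.succ) (r : Fin D) (a : P.Loc i.succ i.succ)
    (b : P.Rest i) : ℂ :=
  P.state U i.succ m r (P.join i a b)

end MeasurementScheme

/-- A run of the concentrating algorithm for the isometry `U`: for all outcomes that occur,
the state before the step of party `i.succ` has a given Koashi-Imoto decomposition, and the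
measurement of party `i.succ` achieves exact merging of this state. -/
structure ConcentratingRun {n : ℕ} (T : AscendingTree n) (d : Fin (n + 1) → ℕ) {D : ℕ}
    (U : EuclideanSpace ℂ (Fin D) →ₗᵢ[ℂ] EuclideanSpace ℂ (∀ k, Fin (d k)))
    extends MeasurementScheme T d where
  M_pos : ∀ i : Fin n, 0 < M i.succ
  ki : ∀ (i : Fin n) (m : {m : toMeasurementScheme.History i.succ //
    toMeasurementScheme.mergeState U i m ≠ 0}), KoashiImoto (toMeasurementScheme.mergeState U i m)
  merging : ∀ (i : Fin n) (m : toMeasurementScheme.History i.succ),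
    toMeasurementScheme.mergeState U i m ≠ 0 →
      IsExactMerging (toMeasurementScheme.mergeState U i m) (toMeasurementScheme.meas i m)

namespace ConcentratingRun

variable {n : ℕ} {T : AscendingTree n} {d : Fin (n + 1) → ℕ} {D : ℕ}
  {U : EuclideanSpace ℂ (Fin D) →ₗᵢ[ℂ] EuclideanSpace ℂ (∀ k, Fin (d k))}

/-- The bound for the edge from the parent of `i.succ` to `i.succ`: the maximum of
`log₂ ⌈λ_j · dim a_j^R⌉` over all outcome tuples `m` that occur (these form a finite nonempty set)
and all blocks `j` of the Koashi-Imoto decomposition, where `λ_j` is the largest eigenvalue of the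
reduced state of `ω_j` on `a_j^L`. -/
def costBound (P : ConcentratingRun T d U) (i : Fin n) : ℝ :=
  ⨆ x : Σ m : {m : P.History i.succ // P.mergeState U i m ≠ 0}, Fin (P.ki i m).J,
    Real.logb 2 (⌈maxSchmidt ((P.ki i x.1).ω x.2) * (P.ki i x.1).aR x.2⌉₊ : ℝ)

end ConcentratingRun

end

/-! Both sides are compared with the rank of the state of party `i.succ` just before it measures. In
the Koashi-Imoto decomposition the weight `maxSchmidt` is at most 1, so the ceiling is at most `aR
j`, a term bounded by `∑ j, aL j * aR j`, which is that rank (`KoashiImoto.ceil_le_rank`). For the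
other comparison, cut the tree into the subtree of `i.succ` and the rest together with the
reference. Every earlier measurement is made by a party whose parent lies on the same side, so its
resource state does not cross the cut and the Schmidt rank cannot grow (`CutRankLE.postState`).
Initially this rank is that of `subtreeState`; in the end `i.succ` alone is left of its subtree
(`rank_mergeState_le`). -/

open scoped Matrix Kronecker

/-! ### Linear algebra: rank factorization and the spectral bound. -/

namespace Matrix

/-- Expand each column in a basis of the column space. This serves as a Schmidt decomposition
without orthogonality. -/
theorem exists_rank_factorization {m k : Type*} [Fintype k] [DecidableEq k] [Finite m]
    (M : Matrix m k ℂ) :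
    ∃ (F : Matrix m (Fin M.rank) ℂ) (G : Matrix (Fin M.rank) k ℂ), M = F * G := by
  let b : Module.Basis (Fin M.rank) ℂ (LinearMap.range M.mulVecLin) :=
    Module.finBasisOfFinrankEq ℂ _ rfl
  refine ⟨of fun i α => (b α : m → ℂ) i,
    of fun α j => b.repr ⟨M.mulVecLin (Pi.single j 1), LinearMap.mem_range_self _ _⟩ α, ?_⟩
  ext i j
  have h := congrArg (fun v : LinearMap.range M.mulVecLin => (v : m → ℂ) i)
    (b.sum_repr ⟨M.mulVecLin (Pi.single j 1), LinearMap.mem_range_self _ _⟩)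
  simp only [AddSubmonoidClass.coe_finsetSum, Submodule.coe_smul, Finset.sum_apply,
    Pi.smul_apply, smul_eq_mul, mulVecLin_apply, mulVec_single_one, col_apply] at h
  rw [mul_apply, ← h]
  simp [mul_comm]

end Matrix

open scoped ComplexOrder in
theorem rank_reducedState {A E : Type*} [Fintype A] [Fintype E] (ψ : A → E → ℂ) :
    (reducedState ψ).rank = (Matrix.of ψ).rank :=
  Matrix.rank_self_mul_conjTranspose _

-- The eigenvalues are nonnegative and sum to the trace, which is the squared norm of `ω`.
open scoped ComplexOrder in
theorem maxSchmidt_le_one {a b : ℕ} (ω : Fin a → Fin b → ℂ) (h : ∑ x, ∑ y, ‖ω x y‖ ^ 2 = 1) :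
    maxSchmidt ω ≤ 1 := by
  have hpos := Matrix.posSemidef_self_mul_conjTranspose (Matrix.of ω)
  have htr := hpos.isHermitian.trace_eq_sum_eigenvalues
  have hsum : ∑ x, hpos.isHermitian.eigenvalues x = 1 := by
    have h1 : (Matrix.of ω * (Matrix.of ω)ᴴ).trace = ((∑ x, ∑ y, ‖ω x y‖ ^ 2 : ℝ) : ℂ) := by
      simp [Matrix.trace, Matrix.mul_apply, Complex.mul_conj, Complex.normSq_eq_norm_sq]
    rw [h1, h] at htr
    exact Complex.ofReal_injective (by simpa using htr.symm)
  refine Real.iSup_le (fun x => ?_) zero_le_one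
  rw [← hsum]
  exact Finset.single_le_sum (fun y _ => hpos.eigenvalues_nonneg y) (Finset.mem_univ x)

/-! ### Dimensions in the Koashi-Imoto decomposition. -/

namespace KoashiImoto

variable {R A B : Type} [Fintype R] [Fintype A] [Fintype B] [DecidableEq R]
    [DecidableEq A] [DecidableEq B] {ψ : R → A → B → ℂ}

-- The isometry `V` has full column rank, and its range is the support of the reduced state.
open scoped ComplexOrder in
theorem sum_aL_mul_aR (κ : KoashiImoto ψ) :
    ∑ j, κ.aL j * κ.aR j = (reducedState fun a (x : R × B) => ψ x.1 a x.2).rank := by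
  have h1 : (reducedState fun a (x : R × B) => ψ x.1 a x.2).rank = κ.V.rank := by
    rw [Matrix.rank, ← κ.V_range, Matrix.rank]
  rw [h1, ← Matrix.rank_conjTranspose_mul_self, κ.V_isometry, Matrix.rank_one]
  simp

theorem aL_pos (κ : KoashiImoto ψ) (j : Fin κ.J) : 0 < κ.aL j := by
  by_contra! h
  have : IsEmpty (Fin (κ.aL j)) := by
    rw [Nat.le_zero.1 h]
    infer_instance
  have := κ.ω_unit j
  simp at this

theorem ceil_le_rank (κ : KoashiImoto ψ) (j : Fin κ.J) :
    ⌈maxSchmidt (κ.ω j) * κ.aR j⌉₊ ≤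
      (reducedState fun a (x : R × B) => ψ x.1 a x.2).rank := by
  calc ⌈maxSchmidt (κ.ω j) * κ.aR j⌉₊ ≤ κ.aR j :=
        Nat.ceil_le.2 (mul_le_of_le_one_left (Nat.cast_nonneg _)
          (maxSchmidt_le_one _ (κ.ω_unit j)))
    _ ≤ κ.aL j * κ.aR j := Nat.le_mul_of_pos_left _ (κ.aL_pos j)
    _ ≤ ∑ j, κ.aL j * κ.aR j :=
        Finset.single_le_sum (f := fun j => κ.aL j * κ.aR j) (fun _ _ => Nat.zero_le _)
          (Finset.mem_univ j)
    _ = _ := κ.sum_aL_mul_aR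

end KoashiImoto

/-! ### Subtrees of the rooted tree. -/

namespace AscendingTree

variable {n : ℕ} (T : AscendingTree n)

theorem self_mem_subtree (k : Fin (n + 1)) : k ∈ T.subtree k :=
  (T.path k).end_mem_support

theorem le_of_mem_subtree {k l : Fin (n + 1)} (h : l ∈ T.subtree k) : k ≤ l :=
  T.ascending l k (T.path l) (T.path_isPath l) h

theorem support_path_succ (i : Fin n) :
    (T.path i.succ).support = (T.path (T.parent i.succ)).support ++ [i.succ] := by
  have hnil : ¬ (T.path i.succ).Nil :=
    SimpleGraph.Walk.not_nil_of_ne (Fin.succ_ne_zero i).symm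
  have h : (T.path i.succ).dropLast = T.path (T.parent i.succ) :=
    (T.isTree.existsUnique_path 0 (T.parent i.succ)).unique
      ((T.path_isPath i.succ).dropLast) (T.path_isPath _)
  rw [← h]
  exact (SimpleGraph.Walk.support_dropLast_concat hnil).symm

/-- The only edge crossing the cut around the subtree of `k` is the one from `k` to its parent. -/
theorem parent_mem_subtree_iff {k : Fin (n + 1)} {i : Fin n} (h : i.succ ≠ k) :
    T.parent i.succ ∈ T.subtree k ↔ i.succ ∈ T.subtree k := by
  simp [subtree, support_path_succ, h.symm]

end AscendingTree

/-! ### Schmidt rank across a subtree cut during the run. -/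

namespace MeasurementScheme

variable {n : ℕ} {T : AscendingTree n} {d : Fin (n + 1) → ℕ} (P : MeasurementScheme T d)

theorem join_castSucc (i : Fin n) (a : P.Loc i.succ i.succ) (b : P.Rest i)
    {l : {l : Fin (n + 1) // l ≤ i.succ}} (h : l.1 ≤ i.castSucc) :
    P.join i a b l = b ⟨l.1, h⟩ := by
  simp [join, h]

theorem join_succ (i : Fin n) (a : P.Loc i.succ i.succ) (b : P.Rest i) :
    P.join i a b ⟨i.succ, le_rfl⟩ = a := by
  have h : ¬ i.succ ≤ i.castSucc := not_le.2 Fin.castSucc_lt_succ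
  simp [join, h]

theorem le_castSucc_or_eq {i : Fin n} (l : {l : Fin (n + 1) // l ≤ i.succ}) :
    l.1 ≤ i.castSucc ∨ l = ⟨i.succ, le_rfl⟩ := by
  by_cases h : l.1 ≤ i.castSucc
  · exact Or.inl h
  · exact Or.inr (Subtype.ext
      (le_antisymm l.2 (Fin.castSucc_lt_iff_succ_le.1 (not_le.1 h))))

/-- The vector `Φ` has Schmidt rank at most `N` with respect to the bipartition into the parties
in `C` on one side, and the reference and the parties outside `C` on the other. -/
def CutRankLE (C : Set (Fin (n + 1))) (N : ℕ) {D : ℕ} {s : Fin (n + 1)}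
    (Φ : Fin D → P.Config s → ℂ) : Prop :=
  ∃ (f : Fin N → P.Config s → ℂ) (g : Fin N → Fin D → P.Config s → ℂ),
    (∀ α z z', (∀ l, l.1 ∈ C → z l = z' l) → f α z = f α z') ∧
    (∀ α r z z', (∀ l, l.1 ∉ C → z l = z' l) → g α r z = g α r z') ∧
    ∀ r z, Φ r z = ∑ α, f α z * g α r z

variable {P} in
/-- A measurement of a party, assisted by a resource state which it shares with a party on the same
side of the cut, does not increase the Schmidt rank. -/
theorem CutRankLE.postState {C : Set (Fin (n + 1))} {N D : ℕ} {i : Fin n}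
    {Φ : Fin D → P.Config i.succ → ℂ} (h : P.CutRankLE C N Φ)
    (hC : T.parent i.succ ∈ C ↔ i.succ ∈ C)
    (μ : P.Loc i.succ i.succ × Fin (P.M i.succ) → ℂ) :
    P.CutRankLE C N (s := i.castSucc) fun r z =>
      postState (fun r a b => Φ r (P.join i a b)) μ r (P.old i z) (P.parentHalf i z) := by
  obtain ⟨f, g, hf, hg, hΦ⟩ := h
  -- The normalization is made an opaque scalar: it may go into either factor, and its value is
  -- irrelevant.
  obtain ⟨c, hc⟩ : ∃ c : ℂ, c =
    (((triNorm (unnormalizedPost (fun r a b => Φ r (P.join i a b)) μ))⁻¹ : ℝ) : ℂ) := ⟨_, rfl⟩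
  simp only [_root_.postState, ← hc, unnormalizedPost]
  have hjoin : ∀ (Q : Fin (n + 1) → Prop) (a a' : P.Loc i.succ i.succ)
      (z z' : P.Config i.castSucc), (∀ l, Q l.1 → z l = z' l) → (Q i.succ → a = a') →
      ∀ l, Q l.1 → P.join i a (P.old i z) l = P.join i a' (P.old i z') l := by
    intro Q a a' z z' hz ha l hl
    rcases le_castSucc_or_eq l with h | rfl
    · rw [join_castSucc _ _ _ _ h, join_castSucc _ _ _ _ h]
      simp only [old, hz ⟨l.1, h⟩ hl]
    · rw [join_succ, join_succ, ha hl]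
  have hhalf : ∀ z z' : P.Config i.castSucc,
      z ⟨T.parent i.succ, T.parent_succ_le i⟩ = z' ⟨T.parent i.succ, T.parent_succ_le i⟩ →
      P.parentHalf i z = P.parentHalf i z' := by
    intro z z' h
    simp only [parentHalf, h]
  -- With no local basis vector the new state is an empty sum, so zero factors suffice.
  rcases isEmpty_or_nonempty (P.Loc i.succ i.succ) with hA | ⟨⟨a₀⟩⟩
  · exact ⟨0, 0, by simp, by simp, by simp⟩
  by_cases hi : i.succ ∈ C
  · refine ⟨fun α z => c * ∑ a, ∑ x, star (μ (a, x)) *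
        (f α (P.join i a (P.old i z)) * maxEntangled (P.M i.succ) x (P.parentHalf i z)),
      fun α r z => g α r (P.join i a₀ (P.old i z)), ?_, ?_, ?_⟩
    · intro α z z' hz
      have hf' : ∀ a, f α (P.join i a (P.old i z)) = f α (P.join i a (P.old i z')) :=
        fun a => hf _ _ _ (hjoin (· ∈ C) a a z z' hz fun _ => rfl)
      simp only [hhalf z z' (hz _ (hC.2 hi)), hf']
    · intro α r z z' hz
      exact hg _ _ _ _ (hjoin (· ∉ C) a₀ a₀ z z' hz fun _ => rfl)
    · intro r z
      have hg' : ∀ α a, g α r (P.join i a (P.old i z)) = g α r (P.join i a₀ (P.old i z)) :=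
        fun α a => hg _ _ _ _ (hjoin (· ∉ C) a a₀ z z (fun _ _ => rfl) fun h => (h hi).elim)
      simp only [hΦ, hg', Finset.mul_sum, Finset.sum_mul]
      conv_rhs => rw [Finset.sum_comm]
      refine Finset.sum_congr rfl fun a _ => ?_
      rw [Finset.sum_comm]
      exact Finset.sum_congr rfl fun α _ => Finset.sum_congr rfl fun x _ => by ring
  -- Mirror case: both parties lie outside `C`, and `g` absorbs the measurement.
  · refine ⟨fun α z => f α (P.join i a₀ (P.old i z)),
      fun α r z => c * ∑ a, ∑ x, star (μ (a, x)) *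
        (g α r (P.join i a (P.old i z)) * maxEntangled (P.M i.succ) x (P.parentHalf i z)),
      ?_, ?_, ?_⟩
    · intro α z z' hz
      exact hf _ _ _ (hjoin (· ∈ C) a₀ a₀ z z' hz fun _ => rfl)
    · intro α r z z' hz
      have hg' : ∀ a, g α r (P.join i a (P.old i z)) = g α r (P.join i a (P.old i z')) :=
        fun a => hg _ _ _ _ (hjoin (· ∉ C) a a z z' hz fun _ => rfl)
      simp only [hhalf z z' (hz _ (mt hC.1 hi)), hg']
    · intro r z
      have hf' : ∀ α a, f α (P.join i a (P.old i z)) = f α (P.join i a₀ (P.old i z)) :=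
        fun α a => hf _ _ _ (hjoin (· ∈ C) a a₀ z z (fun _ _ => rfl) fun h => (hi h).elim)
      simp only [hΦ, hf', Finset.mul_sum]
      conv_rhs => rw [Finset.sum_comm]
      refine Finset.sum_congr rfl fun a _ => ?_
      conv_rhs => rw [Finset.sum_comm]
      refine Finset.sum_congr rfl fun x _ => ?_
      simp only [Finset.sum_mul, Finset.mul_sum]
      exact Finset.sum_congr rfl fun α _ => by ring

variable {D : ℕ} (U : EuclideanSpace ℂ (Fin D) →ₗᵢ[ℂ] EuclideanSpace ℂ (∀ k, Fin (d k)))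

theorem state_last (m : P.History (Fin.last n)) :
    P.state U (Fin.last n) m =
      fun r z => codeState d U r fun k => (z ⟨k, Fin.le_last k⟩).1 := by
  simp [state]

theorem state_castSucc (i : Fin n) (m : P.History i.castSucc) :
    P.state U i.castSucc m = fun r z =>
      postState (fun r a b => P.state U i.succ (P.prevHistory i m) r (P.join i a b))
        (P.meas i (P.prevHistory i m) (P.lastOutcome i m)) r (P.old i z) (P.parentHalf i z) := by
  simp [state]

open scoped Classical in
theorem cutRankLE_state_last (k : Fin (n + 1)) (m : P.History (Fin.last n)) :
    P.CutRankLE (T.subtree k) (subtreeState d U T k).rank (P.state U (Fin.last n) m) := by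
  rw [state_last, subtreeState, rank_reducedState]
  obtain ⟨F, G, hFG⟩ := Matrix.exists_rank_factorization
    (Matrix.of fun x (e : Fin D × (∀ v : {v // v ∉ T.subtree k}, Fin (d v))) =>
      codeState d U e.1
        ((Equiv.piEquivPiSubtypeProd (· ∈ T.subtree k) fun v => Fin (d v)).symm (x, e.2)))
  refine ⟨fun α z => F (fun v => (z ⟨v, Fin.le_last _⟩).1) α,
    fun α r z => G α (r, fun v => (z ⟨v, Fin.le_last _⟩).1), ?_, ?_, ?_⟩
  · intro α z z' hz
    exact congrArg (F · α) (funext fun v => congrArg Prod.fst (hz ⟨v.1, Fin.le_last _⟩ v.2))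
  · intro α r z z' hz
    exact congrArg (fun x => G α (r, x))
      (funext fun v => congrArg Prod.fst (hz ⟨v.1, Fin.le_last _⟩ v.2))
  · intro r z
    have h := congrFun (congrFun hFG fun v => (z ⟨v, Fin.le_last _⟩).1)
      (r, fun v => (z ⟨v, Fin.le_last _⟩).1)
    rw [Matrix.mul_apply] at h
    rw [← h, Matrix.of_apply]
    exact congrArg (codeState d U r)
      (((Equiv.piEquivPiSubtypeProd (· ∈ T.subtree k) fun v => Fin (d v)).symm_apply_apply
      fun v => (z ⟨v, Fin.le_last _⟩).1).symm)

-- Downward induction on the stage: as long as `k` has not measured, each acting party differs from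
-- `k`, so its resource edge stays on one side of the cut.
open scoped Classical in
theorem cutRankLE_state (k s : Fin (n + 1)) (hs : k ≤ s) (m : P.History s) :
    P.CutRankLE (T.subtree k) (subtreeState d U T k).rank (P.state U s m) := by
  induction s using Fin.reverseInduction with
  | last => exact P.cutRankLE_state_last U k m
  | cast i ih =>
    have hk : k < i.succ := Fin.le_castSucc_iff.1 hs
    rw [state_castSucc]
    exact (ih hk.le (P.prevHistory i m)).postState (T.parent_mem_subtree_iff hk.ne') _

open scoped Classical in
/-- The Schmidt rank of the state between party `i.succ` and the remaining systems is at most that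
of the initial state between the subtree of `i.succ` and its complement. -/
theorem rank_mergeState_le (i : Fin n) (m : P.History i.succ) :
    (reducedState fun a (x : Fin D × P.Rest i) => P.mergeState U i m x.1 a x.2).rank ≤
      (subtreeState d U T i.succ).rank := by
  rw [rank_reducedState]
  obtain ⟨f, g, hf, hg, hΦ⟩ := P.cutRankLE_state U i.succ i.succ le_rfl m
  rcases isEmpty_or_nonempty (P.Loc i.succ i.succ) with hA | ⟨⟨a₀⟩⟩
  · exact (Matrix.rank_le_card_height _).trans (by simp)
  rcases isEmpty_or_nonempty (P.Rest i) with hB | ⟨⟨b₀⟩⟩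
  · exact (Matrix.rank_le_card_width _).trans (by simp)
  -- The labelling is ascending, so `i.succ` is the only label at most `i.succ` in its subtree.
  -- Hence `f` depends on `a` alone and `g` on `r` and `b` alone, and the coefficient matrix factors
  -- through the index set of `α`.
  have h : (Matrix.of fun a (x : Fin D × P.Rest i) => P.mergeState U i m x.1 a x.2) =
      (Matrix.of fun a α => f α (P.join i a b₀)) *
        (Matrix.of fun α (x : Fin D × P.Rest i) => g α x.1 (P.join i a₀ x.2)) := by
    ext a ⟨r, b⟩
    rw [Matrix.mul_apply, Matrix.of_apply, mergeState, hΦ]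
    refine Finset.sum_congr rfl fun α _ => ?_
    rw [Matrix.of_apply, Matrix.of_apply]
    congr 1
    · refine hf _ _ _ fun l hl => ?_
      have hl' : l = ⟨i.succ, le_rfl⟩ :=
        Subtype.ext (le_antisymm l.2 (T.le_of_mem_subtree hl))
      rw [hl', join_succ, join_succ]
    · refine hg _ _ _ _ fun l hl => ?_
      rcases le_castSucc_or_eq l with h | rfl
      · rw [join_castSucc _ _ _ _ h, join_castSucc _ _ _ _ h]
      · exact (hl (T.self_mem_subtree _)).elim
  rw [h]
  exact (Matrix.rank_mul_le_left _ _).trans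
    ((Matrix.rank_le_card_width _).trans (Fintype.card_fin _).le)

end MeasurementScheme

/-! ### Passing to logarithms and the conclusion. -/

theorem Real.logb_natCast_le_logb_natCast {a b : ℕ} (h : a ≤ b) :
    Real.logb 2 (a : ℝ) ≤ Real.logb 2 (b : ℝ) := by
  rcases Nat.eq_zero_or_pos a with rfl | ha
  · rcases Nat.eq_zero_or_pos b with rfl | hb
    · rfl
    · simpa using Real.logb_nonneg one_lt_two (Nat.one_le_cast.2 hb)
  · exact Real.logb_le_logb_of_le one_lt_two (Nat.cast_pos.2 ha) (Nat.cast_le.2 h)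

open scoped Classical in
theorem ConcentratingRun.costBound_le_spreadingCost {n : ℕ} {T : AscendingTree n}
    {d : Fin (n + 1) → ℕ} {D : ℕ}
    {U : EuclideanSpace ℂ (Fin D) →ₗᵢ[ℂ] EuclideanSpace ℂ (∀ k, Fin (d k))}
    (P : ConcentratingRun T d U) (i : Fin n) : P.costBound i ≤ spreadingCost d U T i := by
  refine Real.iSup_le (fun x => ?_) ?_
  · exact Real.logb_natCast_le_logb_natCast
      (((P.ki i x.1).ceil_le_rank x.2).trans (P.rank_mergeState_le U i x.1))
  -- A real supremum over an empty family is 0, so the bound must be nonnegative; `logb 2 0 = 0`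
  -- turns this into monotonicity.
  · simpa [spreadingCost] using Real.logb_natCast_le_logb_natCast (Nat.zero_le (subtreeState d U T i.succ).rank)

theorem theorem3 {n : ℕ} (T : AscendingTree n) (d : Fin (n + 1) → ℕ) {D : ℕ} (hD : 0 < D)
    (U : EuclideanSpace ℂ (Fin D) →ₗᵢ[ℂ] EuclideanSpace ℂ (∀ k, Fin (d k)))
    (P : ConcentratingRun T d U) :
    (∀ i : Fin n, P.costBound i ≤ spreadingCost d U T i) ∧
    ((∀ i : Fin n, Real.logb 2 (P.M i.succ) = P.costBound i) →
      ∑ i : Fin n, Real.logb 2 (P.M i.succ) ≤ ∑ i : Fin n, spreadingCost d U T i) := by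
  have h := P.costBound_le_spreadingCost
  exact ⟨h, fun hM => Finset.sum_le_sum fun i _ => (hM i).le.trans (h i)⟩
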